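/- A network with nodes $0,\dots,m-1$ is a dynamic graph $\mathbb G=(\mathbb G(t))_{t\ge 1}$, a sequence of directed graphs on these nodes, in which each node $i$ has an activation round $t_i\ge 1$: for $t<t_i$ (passive) it is isolated in $\mathbb G(t)$, without a self-loop, and for $t\ge t_i$ (active) it has a self-loop in $\mathbb G(t)$. The dynamic diameter of $\mathbb G$ is the infimum of the integers $d>0$ such that for all nodes $i,j$ and all $t\ge 0$ such that every node is active in round $t+1$, $(i,j)$ is an arc of the product $\mathbb G(t+1)\circ\cdots\circ\mathbb G(t+d)$, i.e. there are nodes $i=k_0,k_1,\dots,k_d=j$ such that $(k_{l-1},k_l)$ is an arc of $\mathbb G(t+l)$ for $l=1,\dots,d$. An algorithm consists of a set $\mathcal Q$ of states, a non-empty set $\mathcal Q_0\subseteq\mathcal Q$ of initial states, a set $\mathcal M$ of messages, a sending function $\sigma:\mathcal Q\to\mathcal M$, a transition function $\tau$ that maps a state and a non-empty finite multiset of messages to a state, and an integer-valued clock $C:\mathcal Q\to\mathbb Z$. In an execution in $\mathbb G$, every node $i$ has an initial state $s_i(0)\in\mathcal Q_0$; in round $t$, a passive node keeps its state, and an active node $i$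 moves from $s_i(t-1)$ to $s_i(t)=\tau(s_i(t-1),M)$, where $M$ is the multiset of the messages $\sigma(s_j(t-1))$ over all arcs $(j,i)$ of $\mathbb G(t)$. For an integer $P>1$, the algorithm solves mod $P$-synchronization in a class of networks if in every execution in a network of the class there are $c\in\mathbb Z$ and $t_0\in\mathbb N$ such that $C(s_i(t))\equiv t+c \pmod P$ for all $t\ge t_0$ and all nodes $i$. **Theorem.** Let $P>1$ and $n\ge 1$ be integers. Any algorithm that solves mod $P$-synchronization in the class of networks with finite dynamic diameter and at most $n$ nodes has at least $$1+\Big\lfloor \frac{1}{1.11}\log\Big(\frac n2\Big)\Big\rfloor$$ states ($\log$ is the natural logarithm). In particular, the number of states is $\Omega(\log n)$: there is a constant $c>0$, independent of $P$ and of the algorithm, such that for all sufficiently large $n$ every such algorithm has at least $c\log n$ states. -/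

import Mathlib

universe u v

namespace ClockSync

/-- A dynamic graph on the nodes `0, …, m - 1`: the directed graph of round `t` (`t ≥ 1`) is
`Adj t`, where `Adj t i j` means that `j` receives in round `t` the message sent by `i`.
Node `i` becomes active in round `start i ≥ 1`. A passive node is isolated (without self-loop),
an active node has a self-loop. Hence `start` is determined by `Adj`, and `Adj 0` is empty. -/
structure DynamicGraph (m : ℕ) where
  Adj : ℕ → Fin m → Fin m → Prop
  start : Fin m → ℕ
  one_le_start : ∀ i, 1 ≤ start i
  adj_self : ∀ t i, start i ≤ t → Adj t i i
  active_of_adj : ∀ t i j, Adj t i j → start i ≤ t ∧ start j ≤ t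

namespace DynamicGraph

variable {m : ℕ}

/-- `G.arc t d` is the arc relation of the product `G(t+1) ∘ G(t+2) ∘ ⋯ ∘ G(t+d)`
(for `d = 0`, the empty product: equality). -/
def arc (G : DynamicGraph m) (t : ℕ) : ℕ → Fin m → Fin m → Prop
  | 0 => fun i j => i = j
  | d + 1 => fun i j => ∃ k, G.arc t d i k ∧ G.Adj (t + d + 1) k j

/-- The dynamic diameter: the infimum of all `d > 0` such that every `(i, j)` is an arc of
`G(t+1) ∘ ⋯ ∘ G(t+d)`, for every `t` such that all the nodes are active in round `t + 1`.
(A node which is passive in round `t + 1` has no arc at all in such a product.) -/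
noncomputable def dynamicDiameter (G : DynamicGraph m) : ℕ∞ :=
  ⨅ d ∈ {d : ℕ | 0 < d ∧ ∀ t : ℕ, (∀ i, G.start i ≤ t + 1) → ∀ i j, G.arc t d i j}, (d : ℕ∞)

end DynamicGraph

/-- A class of networks: a set of dynamic graphs of arbitrary finite sizes. -/
abbrev NetworkClass : Type := Set (Σ m : ℕ, DynamicGraph m)

/-- The networks with at most `n` nodes and with a finite dynamic diameter. -/
def finiteDiameterClass (n : ℕ) : NetworkClass :=
  {G | G.1 ≤ n ∧ G.2.dynamicDiameter < ⊤}

/-- A deterministic anonymous broadcast algorithm whose local state carries an integer clock.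
The transition function is only ever applied to the non-empty multiset of received messages
of an active node; its value at the empty multiset is irrelevant. -/
structure Algorithm where
  State : Type u
  Msg : Type v
  initial : Set State
  initial_nonempty : initial.Nonempty
  send : State → Msg
  transition : State → Multiset Msg → State
  clock : State → ℤ

namespace Algorithm

variable {m : ℕ}

open Classical in
/-- The multiset of messages received by node `i` in round `t`, when `s` gives the states of
the nodes at the beginning of the round. -/
noncomputable def received (A : Algorithm.{u, v}) (G : DynamicGraph m) (s : Fin m → A.State)
    (t : ℕ) (i : Fin m) : Multiset A.Msg :=
  (Finset.univ.filter fun j => G.Adj t j i).val.map fun j => A.send (s j)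

/-- `A.run G s₀ t i` is the state of node `i` at the end of round `t` in the execution of `A`
in `G` with initial states `s₀`. -/
noncomputable def run (A : Algorithm.{u, v}) (G : DynamicGraph m) (s₀ : Fin m → A.State) :
    ℕ → Fin m → A.State
  | 0 => s₀
  | t + 1 => fun i =>
      if G.start i ≤ t + 1 then
        A.transition (A.run G s₀ t i) (A.received G (A.run G s₀ t) (t + 1) i)
      else A.run G s₀ t i

/-- `A` solves the mod `P`-synchronization problem in the network class `C`. -/
def Solves (A : Algorithm.{u, v}) (P : ℕ) (C : NetworkClass) : Prop :=
  ∀ G ∈ C, ∀ s₀ : Fin G.1 → A.State, (∀ i, s₀ i ∈ A.initial) →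
    ∃ c : ℤ, ∃ t₀ : ℕ, ∀ t : ℕ, t₀ ≤ t → ∀ i : Fin G.1,
      A.clock (A.run G.2 s₀ t i) ≡ (t : ℤ) + c [ZMOD (P : ℤ)]

end Algorithm

end ClockSync

/-! An isolated active node iterates a self-map f of the k states (`isolatedStep`). All periodic
points of f share a period L ≤ 2 ^ k (`exists_common_period`). Two groups of L nodes are started so
that, once periodic, each group occupies x, f x, ..., f^[L-1] x. Such a group broadcasts the same
multiset at all times (`map_iterate_add_univ`). A node listens to the other group only when its own
state is x, so all members of its group make the same transition, one round apart, and the group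
ends up spread over a new orbit (`run_epoch`). This repeats forever although the diameter is finite.
At the start of an epoch one node is in state f x, and one round later another is: equal clock
values at consecutive times, impossible mod P > 1. Hence n < 2 * 2 ^ k. -/

namespace ClockSync

open Function

/-! ### Periodic points of a self-map of a finite set. -/

section Dynamics

/-- A permutation of `k` points has order at most `2 ^ k`. -/
theorem orderOf_perm_le_two_pow {α : Type*} [Fintype α] [DecidableEq α] (σ : Equiv.Perm α) :
    orderOf σ ≤ 2 ^ Fintype.card α := by
  -- The order is the lcm of the cycle lengths, hence at most their product; their sum is at most
  -- the number of points.
  have prod_le (s : Multiset ℕ) : s.prod ≤ 2 ^ s.sum := by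
    induction s using Multiset.induction_on with
    | empty => simp
    | cons a s ih =>
      rw [Multiset.prod_cons, Multiset.sum_cons, pow_add]
      exact Nat.mul_le_mul Nat.lt_two_pow_self.le ih
  have hpos : 0 < σ.cycleType.prod :=
    Multiset.prod_pos fun a ha => (Equiv.Perm.two_le_of_mem_cycleType ha).trans_lt' two_pos
  calc orderOf σ = σ.cycleType.lcm := σ.lcm_cycleType.symm
    _ ≤ σ.cycleType.prod :=
        Nat.le_of_dvd hpos (Multiset.lcm_dvd.2 fun a ha => Multiset.dvd_prod ha)
    _ ≤ 2 ^ σ.cycleType.sum := prod_le _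
    _ ≤ 2 ^ Fintype.card α := by
        rw [Equiv.Perm.sum_cycleType]
        exact Nat.pow_le_pow_right two_pos (Finset.card_le_univ _)

theorem iterate_card_mem_periodicPts {α : Type*} [Fintype α] (f : α → α) (x : α) {j : ℕ}
    (hj : Fintype.card α ≤ j) : f^[j] x ∈ periodicPts f := by
  classical
  obtain ⟨a, ha, b, hb, hab, h⟩ := Finset.exists_ne_map_eq_of_card_lt_of_maps_to
    (s := Finset.range (Fintype.card α + 1)) (t := (Finset.univ : Finset α)) (by simp)
    (f := fun i => f^[i] x) (fun _ _ => by simp)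
  simp only [Finset.mem_range] at ha hb
  wlog hlt : a < b generalizing a b
  · exact this b a hab.symm h.symm hb ha (by omega)
  refine mem_periodicPts.2 ⟨b - a, by omega, ?_⟩
  have hper : IsPeriodicPt f (b - a) (f^[a] x) := by
    change f^[b - a] (f^[a] x) = f^[a] x
    rw [← iterate_add_apply, Nat.sub_add_cancel hlt.le]
    exact h.symm
  have := hper.apply_iterate (j - a)
  rwa [← iterate_add_apply, Nat.sub_add_cancel (by omega)] at this

/-- A self-map of `k` points has a common period, at most `2 ^ k`, of all its periodic points. -/
theorem exists_common_period {α : Type*} [Fintype α] (f : α → α) :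
    ∃ L, 0 < L ∧ L ≤ 2 ^ Fintype.card α ∧ ∀ x ∈ periodicPts f, IsPeriodicPt f L x := by
  classical
  let σ : Equiv.Perm (periodicPts f) := (bijOn_periodicPts f).equiv f
  refine ⟨orderOf σ, orderOf_pos σ, (orderOf_perm_le_two_pow σ).trans
    (Nat.pow_le_pow_right two_pos (Fintype.card_subtype_le _)), fun x hx => ?_⟩
  have hiter (m : ℕ) : (((σ ^ m) ⟨x, hx⟩ : periodicPts f) : α) = f^[m] x := by
    induction m with
    | zero => rfl
    | succ m ih =>
      rw [pow_succ', Equiv.Perm.mul_apply, iterate_succ_apply', ← ih]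
      rfl
  have := hiter (orderOf σ)
  rw [pow_orderOf_eq_one] at this
  exact this.symm

/-- The orbit of a periodic point, as a multiset, does not depend on the point it starts from. -/
theorem map_iterate_add_univ {α β : Type*} {f : α → α} {L : ℕ} {x : α} (hx : IsPeriodicPt f L x)
    (g : α → β) (a : ℕ) :
    (Finset.univ : Finset (Fin L)).val.map (fun j : Fin L => g (f^[a + j] x)) =
      (Finset.univ : Finset (Fin L)).val.map (fun j : Fin L => g (f^[j] x)) := by
  rcases Nat.eq_zero_or_pos L with rfl | hL
  · rfl
  have : NeZero L := ⟨hL.ne'⟩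
  conv_rhs => rw [← Multiset.map_univ_val_equiv (Equiv.addLeft (Fin.ofNat L a)), Multiset.map_map]
  refine Multiset.map_congr rfl fun j _ => ?_
  simp only [comp_apply, Equiv.coe_addLeft, Fin.val_add, Fin.val_ofNat, Nat.mod_add_mod]
  rw [hx.iterate_mod_apply]

end Dynamics

/-! ### Paths padded with self-loops. -/

namespace DynamicGraph

variable {m : ℕ} {G : DynamicGraph m}

theorem arc_self {t : ℕ} (ht : ∀ i, G.start i ≤ t + 1) (d : ℕ) (i : Fin m) : G.arc t d i i := by
  induction d with
  | zero => rfl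
  | succ d ih => exact ⟨i, ih, G.adj_self _ _ ((ht i).trans (by omega))⟩

theorem arc_mono {t d d' : ℕ} (ht : ∀ i, G.start i ≤ t + 1) (hd : d ≤ d') {i j : Fin m}
    (h : G.arc t d i j) : G.arc t d' i j := by
  induction d', hd using Nat.le_induction with
  | base => exact h
  | succ d' _ ih => exact ⟨j, ih, G.adj_self _ _ ((ht j).trans (by omega))⟩

theorem arc_of_adj_adj {t d r r' : ℕ} (ht : ∀ i, G.start i ≤ t + 1) (hr : t < r) (hrr' : r < r')
    (hr' : r' ≤ t + d) {i j k : Fin m} (h : G.Adj r i j) (h' : G.Adj r' j k) : G.arc t d i k := by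
  obtain ⟨a, rfl⟩ := Nat.exists_eq_add_of_lt hr
  obtain ⟨b, rfl⟩ := Nat.exists_eq_add_of_lt hrr'
  refine arc_mono ht (d := a + 1 + b + 1) (by omega) ⟨j, ?_, ?_⟩
  · exact arc_mono ht (d := a + 1) (by omega) ⟨i, arc_self ht a i, h⟩
  · convert h' using 1
    omega

theorem dynamicDiameter_lt_top {d : ℕ} (hd : 0 < d)
    (h : ∀ t : ℕ, (∀ i, G.start i ≤ t + 1) → ∀ i j, G.arc t d i j) : G.dynamicDiameter < ⊤ :=
  (iInf₂_le d ⟨hd, h⟩).trans_lt (ENat.natCast_lt_top d)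

end DynamicGraph

/-! ### The network that defeats synchronization. -/

section ExchangeGraph

variable {L : ℕ}

/-- The `2 * L` nodes are divided into two groups of `L` nodes. -/
def group (v : Fin (2 * L)) : Fin 2 := (finProdFinEquiv.symm v).1

def index (v : Fin (2 * L)) : Fin L := (finProdFinEquiv.symm v).2

def node (b : Fin 2) (j : Fin L) : Fin (2 * L) := finProdFinEquiv (b, j)

@[simp] theorem group_node (b : Fin 2) (j : Fin L) : group (node b j) = b := by simp [group, node]

@[simp] theorem index_node (b : Fin 2) (j : Fin L) : index (node b j) = j := by simp [index, node]

@[simp] theorem node_group_index (v : Fin (2 * L)) : node (group v) (index v) = v :=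
  finProdFinEquiv.apply_symm_apply v

/-- Node `w` listens to the other group in round `t`. Time is divided into epochs of `E` rounds,
the groups listen in alternate epochs, and no node listens in epoch `0`. -/
def Listens (E t : ℕ) (w : Fin (2 * L)) : Prop :=
  1 ≤ (t - 1) / E ∧ (t - 1) / E % 2 = group w ∧ (t - 1) % E = L - index w

theorem listens_iff {E q s : ℕ} (hs : s < E) (w : Fin (2 * L)) :
    Listens E (q * E + s + 1) w ↔ 1 ≤ q ∧ q % 2 = group w ∧ s = L - index w := by
  have hE : 0 < E := by omega
  have h1 : (q * E + s) / E = q := by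
    rw [mul_comm, Nat.mul_add_div hE, Nat.div_eq_of_lt hs, add_zero]
  have h2 : (q * E + s) % E = s := by
    rw [mul_comm, Nat.mul_add_mod, Nat.mod_eq_of_lt hs]
  simp only [Listens, Nat.add_sub_cancel, h1, h2]

/-- The dynamic graph in which the only arcs, besides the self-loops of the active nodes, go to a
listening node from all the nodes of the other group. -/
def exchangeGraph (L E : ℕ) : DynamicGraph (2 * L) where
  Adj t v w := (L - index v ≤ t ∧ L - index w ≤ t) ∧
    (v = w ∨ Listens E t w ∧ group v ≠ group w)
  -- Staggered starts put the node of index j exactly j steps of f ahead of the node of index 0.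
  start v := L - index v
  one_le_start v := by have := (index v).isLt; omega
  adj_self t v h := ⟨⟨h, h⟩, .inl rfl⟩
  active_of_adj t v w h := h.1

theorem exchangeGraph_adj {E q : ℕ} (hLE : L < E) (hq : 1 ≤ q) {v w : Fin (2 * L)}
    (hw : q % 2 = group w) (hvw : group v ≠ group w) :
    (exchangeGraph L E).Adj (q * E + (L - index w) + 1) v w := by
  have : E ≤ q * E := Nat.le_mul_of_pos_left E hq
  exact ⟨⟨by omega, by omega⟩, .inr ⟨(listens_iff (by omega) w).2 ⟨hq, hw, rfl⟩, hvw⟩⟩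

/-- Some epoch `q` in which the group of `w` does not listen begins after `t`, by `t + 2 * E`.
Epochs `q` and `q + 1` then suffice: a node of the same group reaches `w` through a node `u` of the
other group, and a node of the other group reaches it directly. -/
theorem exchangeGraph_dynamicDiameter {E : ℕ} (hLE : L < E) :
    (exchangeGraph L E).dynamicDiameter < ⊤ := by
  refine DynamicGraph.dynamicDiameter_lt_top (d := 4 * E) (by omega) fun t ht v w => ?_
  have hE : 0 < E := by omega
  obtain ⟨q, hq, h1, h2, hpar⟩ : ∃ q, 1 ≤ q ∧ t < q * E ∧ q * E ≤ t + 2 * E ∧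
      (q + 1) % 2 = group w := by
    have hg := (group w).isLt
    have hdiv := Nat.div_add_mod' t E
    have hmod := Nat.mod_lt t hE
    generalize t / E = a, t % E = r at hdiv hmod
    by_cases h : (a + 2) % 2 = group w
    · exact ⟨a + 1, by omega, by linarith, by rw [add_mul]; omega, h⟩
    · exact ⟨a + 2, by omega, by linarith, by rw [add_mul]; omega, by omega⟩
  have h3 : (q + 1) * E = q * E + E := by ring
  have hw := (index w).isLt
  by_cases hvw : group v = group w
  · let u := node (group w + 1) (index w)
    have hu : ((group w + 1 : Fin 2) : ℕ) = q % 2 := by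
      rw [Fin.val_add, ← hpar]
      simp only [Fin.val_one]
      omega
    refine DynamicGraph.arc_of_adj_adj ht ?_ ?_ ?_
      (exchangeGraph_adj (v := v) (w := u) hLE hq (by simp [u, hu]) (by simp [u, hvw]))
      (exchangeGraph_adj (v := u) (w := w) hLE (by omega) hpar (by simp [u]))
    all_goals simp only [u, index_node, h3]; omega
  · refine DynamicGraph.arc_of_adj_adj ht (r := t + 1) (by omega) ?_ ?_
      ((exchangeGraph L E).adj_self _ _ (ht v)) (exchangeGraph_adj hLE (by omega) hpar hvw)
    all_goals omega

end ExchangeGraph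

/-! ### Executions in this network and the resulting bounds. -/

namespace Algorithm

variable {L : ℕ} (A : Algorithm.{u, v})

/-- The transition of an isolated active node. -/
def isolatedStep (q : A.State) : A.State := A.transition q {A.send q}

theorem received_of_not_listens {E t : ℕ} {w : Fin (2 * L)} (s : Fin (2 * L) → A.State)
    (hw : L - index w ≤ t) (h : ¬ Listens E t w) :
    A.received (exchangeGraph L E) s t w = {A.send (s w)} := by
  classical
  have : (Finset.univ.filter fun v => (exchangeGraph L E).Adj t v w) = {w} := by
    ext v
    rw [Finset.mem_filter, Finset.mem_singleton]
    simp only [exchangeGraph, Finset.mem_univ, true_and]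
    constructor
    · rintro ⟨-, rfl | h'⟩
      exacts [rfl, absurd h'.1 h]
    · rintro rfl
      exact ⟨⟨hw, hw⟩, .inl rfl⟩
  have key := congrArg (fun S : Finset (Fin (2 * L)) => S.val.map fun j => A.send (s j)) this
  simp only [Finset.singleton_val, Multiset.map_singleton] at key
  rw [← key, received]

theorem received_of_listens {E t : ℕ} {w : Fin (2 * L)} (s : Fin (2 * L) → A.State)
    (ht : ∀ v : Fin (2 * L), L - index v ≤ t) (h : Listens E t w) :
    A.received (exchangeGraph L E) s t w = A.send (s w) ::ₘ
      (Finset.univ : Finset (Fin L)).val.map fun j => A.send (s (node (group w + 1) j)) := by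
  classical
  have hne (b : Fin 2) : b + 1 ≠ b := by revert b; decide
  have heq (b c : Fin 2) (hbc : c ≠ b) : b + 1 = c := by revert b c; decide
  have hinj : Injective (node (L := L) (group w + 1)) := fun i j hij => by
    simpa using congrArg index hij
  have hnot : w ∉ Finset.univ.map ⟨node (L := L) (group w + 1), hinj⟩ := by
    simp only [Finset.mem_map, Finset.mem_univ, true_and, Embedding.coeFn_mk, not_exists]
    intro j hj
    have := congrArg group hj
    rw [group_node] at this
    exact hne _ this
  have : (Finset.univ.filter fun v => (exchangeGraph L E).Adj t v w) =
      Finset.cons w (Finset.univ.map ⟨node (L := L) (group w + 1), hinj⟩) hnot := by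
    ext v
    rw [Finset.mem_filter, Finset.mem_cons, Finset.mem_map]
    simp only [exchangeGraph, Finset.mem_univ, true_and, Embedding.coeFn_mk]
    constructor
    · rintro ⟨-, rfl | ⟨-, h'⟩⟩
      · exact .inl rfl
      · exact .inr ⟨index v, by rw [heq _ _ h', node_group_index]⟩
    · rintro (rfl | ⟨j, rfl⟩)
      · exact ⟨⟨ht _, ht _⟩, .inl rfl⟩
      · exact ⟨⟨ht _, ht _⟩, .inr ⟨h, by simp⟩⟩
  have key := congrArg (fun S : Finset (Fin (2 * L)) => S.val.map fun j => A.send (s j)) this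
  simp only [Finset.cons_val, Multiset.map_cons, Finset.map_val, Multiset.map_map] at key
  exact key

theorem run_succ_apply {m : ℕ} (G : DynamicGraph m) (s₀ : Fin m → A.State) (t : ℕ) (i : Fin m) :
    A.run G s₀ (t + 1) i = if G.start i ≤ t + 1 then
      A.transition (A.run G s₀ t i) (A.received G (A.run G s₀ t) (t + 1) i)
      else A.run G s₀ t i := rfl

theorem run_succ_of_not_listens {E t : ℕ} {w : Fin (2 * L)} (s₀ : Fin (2 * L) → A.State)
    (hw : L - index w ≤ t + 1) (h : ¬ Listens E (t + 1) w) :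
    A.run (exchangeGraph L E) s₀ (t + 1) w =
      A.isolatedStep (A.run (exchangeGraph L E) s₀ t w) := by
  rw [run_succ_apply, if_pos (show (exchangeGraph L E).start w ≤ t + 1 from hw),
    A.received_of_not_listens _ hw h, isolatedStep]

/-- Nobody listens in epoch 0. The truncated subtraction makes the exponent 0 while `w` is passive.
-/
theorem run_first_epoch {E : ℕ} (q₀ : A.State) (w : Fin (2 * L)) {t : ℕ} (ht : t ≤ E) :
    A.run (exchangeGraph L E) (fun _ => q₀) t w =
      A.isolatedStep^[t + 1 - (L - index w)] q₀ := by
  have hidx := (index w).isLt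
  induction t with
  | zero =>
    rw [show 0 + 1 - (L - (index w : ℕ)) = 0 by omega]
    rfl
  | succ t ih =>
    by_cases hw : L - index w ≤ t + 1
    · have hl : ¬ Listens E (t + 1) w := by
        have := listens_iff (E := E) (q := 0) (s := t) (by omega) w
        simp only [zero_mul, zero_add] at this
        rw [this]
        omega
      rw [A.run_succ_of_not_listens _ hw hl, ih (by omega), ← iterate_succ_apply' A.isolatedStep]
      congr 1
      omega
    · rw [run_succ_apply, if_neg (show ¬ (exchangeGraph L E).start w ≤ t + 1 from hw), ih (by omega)]
      congr 1
      omega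

/-- Within an epoch, the nodes of the listening group leave their common orbit one after the
other, all from the same state and for the same state. -/
theorem run_epoch {E q : ℕ} (hLE : L < E) (hq : 1 ≤ q) (s₀ : Fin (2 * L) → A.State)
    {x : Fin 2 → A.State} (hx : ∀ b, IsPeriodicPt A.isolatedStep L (x b))
    (hrun : ∀ w, A.run (exchangeGraph L E) s₀ (q * E) w =
      A.isolatedStep^[index w] (x (group w))) :
    ∃ y : A.State, ∀ s ≤ E, ∀ w, A.run (exchangeGraph L E) s₀ (q * E + s) w =
      if q % 2 = group w ∧ L - index w < s then A.isolatedStep^[s - (L - index w) - 1] y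
      else A.isolatedStep^[s + index w] (x (group w)) := by
  obtain ⟨b, hb⟩ : ∃ b : Fin 2, q % 2 = b := ⟨⟨q % 2, Nat.mod_lt _ two_pos⟩, rfl⟩
  -- The common state after listening: every listener is in state `x b` and hears the whole orbit of
  -- `x (b + 1)`.
  refine ⟨A.transition (x b) (A.send (x b) ::ₘ (Finset.univ : Finset (Fin L)).val.map
    fun j : Fin L => A.send (A.isolatedStep^[j] (x (b + 1)))), fun s hs => ?_⟩
  have hqE : E ≤ q * E := Nat.le_mul_of_pos_left E hq
  induction s with
  | zero => intro w; simpa using hrun w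
  | succ s ih =>
    intro w
    have hidx := (index w).isLt
    specialize ih (by omega)
    have hlw := listens_iff (E := E) (q := q) (s := s) (by omega) w
    rw [← add_assoc]
    by_cases hl : q % 2 = group w ∧ s = L - index w
    · have hgw : group w = b := Fin.ext (hl.1.symm.trans hb)
      have hne : (b : ℕ) ≠ ((b + 1 : Fin 2) : ℕ) :=
        (by decide : ∀ b : Fin 2, (b : ℕ) ≠ ((b + 1 : Fin 2) : ℕ)) b
      rw [run_succ_apply, if_pos (show (exchangeGraph L E).start w ≤ q * E + s + 1 by
          simp only [exchangeGraph]; omega),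
        A.received_of_listens _ (fun v => by omega) (hlw.2 ⟨hq, hl⟩), ih w,
        if_neg (by omega), if_pos ⟨hl.1, by omega⟩, hgw,
        show s + 1 - (L - (index w : ℕ)) - 1 = 0 by omega, iterate_zero, id,
        show s + (index w : ℕ) = L by omega, (hx b).eq]
      congr 2
      -- The other group has advanced `s` steps along its orbit, which only permutes the messages.
      rw [← map_iterate_add_univ (hx (b + 1)) A.send s]
      refine Multiset.map_congr rfl fun j _ => ?_
      rw [ih, if_neg (by rw [group_node, hb]; exact fun h => hne h.1), group_node, index_node]
    · rw [A.run_succ_of_not_listens _ (by omega) (by rw [hlw]; exact fun h => hl h.2), ih w]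
      by_cases hc : q % 2 = group w ∧ L - index w < s
      · rw [if_pos hc, if_pos ⟨hc.1, by omega⟩, ← iterate_succ_apply' A.isolatedStep]
        congr 1
        omega
      · rw [if_neg hc, if_neg (by omega), ← iterate_succ_apply' A.isolatedStep]
        congr 1
        omega

/-- At the beginning of each epoch, each group covers a whole orbit of periodic states. -/
theorem exists_periodic_run {E k : ℕ} (hdvd : L ∣ E) (hkE : L + k < E) (q₀ : A.State)
    (hk : ∀ y, ∀ j ≥ k, IsPeriodicPt A.isolatedStep L (A.isolatedStep^[j] y)) {q : ℕ}
    (hq : 1 ≤ q) :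
    ∃ x : Fin 2 → A.State, (∀ b, IsPeriodicPt A.isolatedStep L (x b)) ∧
      ∀ w, A.run (exchangeGraph L E) (fun _ => q₀) (q * E) w =
        A.isolatedStep^[index w] (x (group w)) := by
  induction q, hq using Nat.le_induction with
  | base =>
    refine ⟨fun _ => A.isolatedStep^[E + 1 - L] q₀, fun _ => hk _ _ (by omega), fun w => ?_⟩
    have hidx := (index w).isLt
    rw [one_mul, A.run_first_epoch q₀ w le_rfl, ← iterate_add_apply]
    congr 1
    omega
  | succ q hq ih =>
    obtain ⟨x, hx, hrun⟩ := ih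
    obtain ⟨y, hy⟩ := A.run_epoch (by omega) hq _ hx hrun
    -- After listening, index j has E - (L - j) - 1 = (E - L - 1) + j rounds left, and E - L - 1 ≥ k
    -- makes the new base state periodic. The other group advances by E, a multiple of L, so it
    -- returns to its old states.
    refine ⟨fun b => if q % 2 = b then A.isolatedStep^[E - L - 1] y else x b, fun b => ?_,
      fun w => ?_⟩
    · dsimp only
      split_ifs
      exacts [hk _ _ (by omega), hx b]
    · have hidx := (index w).isLt
      rw [add_mul, one_mul, hy E le_rfl w]
      dsimp only
      by_cases h : q % 2 = group w
      · rw [if_pos ⟨h, by omega⟩, if_pos h, ← iterate_add_apply]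
        congr 1
        omega
      · rw [if_neg (fun h' => h h'.1), if_neg h, add_comm, iterate_add_apply]
        congr 1
        exact (hx _).trans_dvd hdvd

/-- An algorithm with `k` states does not synchronize all networks with `2 ^ (k + 1)` nodes. -/
theorem lt_two_pow_of_solves {P n : ℕ} (hP : 1 < P) [Fintype A.State]
    (hA : A.Solves P (finiteDiameterClass n)) : n < 2 * 2 ^ Fintype.card A.State := by
  by_contra! hn
  obtain ⟨L, hL, hL2, hper⟩ := exists_common_period A.isolatedStep
  obtain ⟨q₀, hq₀⟩ := A.initial_nonempty
  set k := Fintype.card A.State with hkdef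
  set E := L * (k + 2) with hEdef
  have hkE : L + k < E := by
    have : k ≤ L * k := Nat.le_mul_of_pos_left k hL
    have : E = L * k + 2 * L := by rw [hEdef]; ring
    have hk : 0 < k := Fintype.card_pos_iff.2 ⟨q₀⟩
    omega
  obtain ⟨c, t₀, hsync⟩ := hA ⟨2 * L, exchangeGraph L E⟩
    ⟨(Nat.mul_le_mul_left 2 hL2).trans hn, exchangeGraph_dynamicDiameter (by omega)⟩
    (fun _ => q₀) (fun _ => hq₀)
  have hq : t₀ ≤ (t₀ + 1) * E :=
    (Nat.le_succ t₀).trans (Nat.le_mul_of_pos_right _ (by omega))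
  obtain ⟨x, hx, hrun⟩ := A.exists_periodic_run (k := k) (Dvd.intro _ rfl) hkE q₀
    (fun y j hj => hper _ (iterate_card_mem_periodicPts _ y hj)) (Nat.le_add_left 1 t₀)
  -- If L = 1, this is the node of index 0 itself, and periodicity still gives its state as f x.
  have h1 := hsync ((t₀ + 1) * E) hq (node 0 ⟨1 % L, Nat.mod_lt _ hL⟩)
  have h2 := hsync ((t₀ + 1) * E + 1) (by omega) (node 0 ⟨0, hL⟩)
  dsimp only at h1 h2
  have hl : ¬ Listens E ((t₀ + 1) * E + 1) (node 0 (⟨0, hL⟩ : Fin L)) := by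
    have := listens_iff (E := E) (q := t₀ + 1) (s := 0) (by omega) (node 0 (⟨0, hL⟩ : Fin L))
    rw [add_zero] at this
    rw [this, index_node]
    simp only [tsub_zero]
    omega
  rw [A.run_succ_of_not_listens _ (by
    have : E ≤ (t₀ + 1) * E := Nat.le_mul_of_pos_left E (by omega)
    omega) hl] at h2
  rw [hrun, group_node, index_node] at h1 h2
  rw [(hx 0).iterate_mod_apply 1, iterate_one] at h1
  simp only [iterate_zero, id] at h2
  have h3 := h1.symm.trans h2
  push_cast at h3
  have h4 : (P : ℤ) ∣ 1 := by
    have := h3.dvd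
    ring_nf at this
    exact this
  have := Int.le_of_dvd one_pos h4
  omega

theorem log_lt_of_solves {P n : ℕ} (hP : 1 < P) (hn : 1 ≤ n) [Fintype A.State]
    (hA : A.Solves P (finiteDiameterClass n)) :
    Real.log (n / 2) < Fintype.card A.State * Real.log 2 := by
  have hlt : (n : ℝ) < 2 * 2 ^ Fintype.card A.State := by
    exact_mod_cast A.lt_two_pow_of_solves hP hA
  rw [← Real.log_pow]
  have : (0 : ℝ) < n := by exact_mod_cast hn
  exact Real.log_lt_log (by positivity) (by linarith)

theorem le_card_state_of_solves {P n : ℕ} (hP : 1 < P) (hn : 1 ≤ n)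
    (hA : A.Solves P (finiteDiameterClass n)) :
    ((1 + ⌊(1 / 1.11 : ℝ) * Real.log ((n : ℝ) / 2)⌋).toNat : ℕ∞) ≤ ENat.card A.State := by
  cases finite_or_infinite A.State with
  | inr h => simp
  | inl h =>
    have := Fintype.ofFinite A.State
    have hlog := A.log_lt_of_solves hP hn hA
    rw [ENat.card_eq_coe_fintype_card, Nat.cast_le, Int.toNat_le]
    suffices ⌊(1 / 1.11 : ℝ) * Real.log ((n : ℝ) / 2)⌋ < (Fintype.card A.State : ℤ) by omega
    rw [Int.floor_lt, Int.cast_natCast]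
    have h2 := Real.log_two_lt_d9
    have hk : (0 : ℝ) ≤ Fintype.card A.State := Nat.cast_nonneg _
    -- The constant 1.11 is not sharp here: log 2 would do.
    have : (Fintype.card A.State : ℝ) * Real.log 2 ≤ Fintype.card A.State * 1.11 :=
      mul_le_mul_of_nonneg_left (by linarith) hk
    rw [one_div, inv_mul_lt_iff₀ (by norm_num)]
    linarith

end Algorithm

end ClockSync

theorem theorem5 :
    (∀ (P n : ℕ), 1 < P → 1 ≤ n → ∀ A : ClockSync.Algorithm.{u, v},
      A.Solves P (ClockSync.finiteDiameterClass n) →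
        ((1 + ⌊(1 / 1.11 : ℝ) * Real.log ((n : ℝ) / 2)⌋).toNat : ℕ∞) ≤ ENat.card A.State) ∧
    (∃ c : ℝ, 0 < c ∧ ∀ᶠ n : ℕ in Filter.atTop, ∀ P : ℕ, 1 < P →
      ∀ A : ClockSync.Algorithm.{u, v},
        A.Solves P (ClockSync.finiteDiameterClass n) →
          (⌈c * Real.log (n : ℝ)⌉₊ : ℕ∞) ≤ ENat.card A.State) := by
  refine ⟨fun P n hP hn A hA => A.le_card_state_of_solves hP hn hA, 1 / 2, by norm_num, ?_⟩
  filter_upwards [Filter.eventually_ge_atTop 4] with n hn P hP A hA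
  cases finite_or_infinite A.State with
  | inr h => simp
  | inl h =>
    have := Fintype.ofFinite A.State
    have hlog := A.log_lt_of_solves hP (by omega) hA
    rw [ENat.card_eq_coe_fintype_card, Nat.cast_le, Nat.ceil_le]
    have hn' : (4 : ℝ) ≤ n := by exact_mod_cast hn
    rw [Real.log_div (by positivity) two_ne_zero] at hlog
    -- For n ≥ 4, log n - log 2 ≥ (log n) / 2, whence the constant 1 / 2.
    have h4 : 2 * Real.log 2 ≤ Real.log n := by
      rw [← Real.log_rpow two_pos]
      exact Real.log_le_log (by positivity) (by norm_num; exact_mod_cast hn)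
    have h2 := Real.log_two_lt_d9
    have hk : (0 : ℝ) ≤ Fintype.card A.State := Nat.cast_nonneg _
    have : (Fintype.card A.State : ℝ) * Real.log 2 ≤ Fintype.card A.State * 1 :=
      mul_le_mul_of_nonneg_left (by linarith) hk
    linarith
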